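/- **Theorem (chordal bipartite graphs avoiding a fixed chain graph).** All graphs are finite and simple. A *chain graph* is a bipartite graph with a bipartition $(A,B)$ such that the neighbourhoods of the vertices of $A$ are linearly ordered by inclusion. A bipartite graph is *chordal bipartite* if it has no induced cycle of length at least $6$. A graph is *$H$-free* if it has no induced subgraph isomorphic to $H$. A class $\mathcal X$ of graphs *admits an implicit representation* if there are a computable function $D:\{0,1\}^*\times\{0,1\}^*\to\{0,1\}$ and a constant $c$, depending only on $\mathcal X$, such that for every $n$-vertex graph $G=(V,E)\in\mathcal X$ each vertex $v\in V$ can be assigned a binary code $\ell(v)\in\{0,1\}^*$ of length at most $c(\lfloor\log_2 n\rfloor+1)$ (that is, $O(\log n)$; for $n=0$ there is nothing to assign) in such a way that, for all $x,y\in V$, $xy\in E$ if and only if $D(\ell(x),\ell(y))=1$. For every fixed chain graph $H$, the class of $H$-free chordal bipartite graphs admits an implicit representation. -/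

import Mathlib

/-- A chain graph: a bipartite graph with a bipartition `(A, B)` of its vertex set such that the
neighbourhoods of the vertices of the part `A` are linearly ordered by inclusion. -/
def IsChainGraph {V : Type*} (G : SimpleGraph V) : Prop :=
  ∃ A B : Set V, A ∪ B = Set.univ ∧ G.IsBipartiteWith A B ∧
    ∀ x ∈ A, ∀ y ∈ A,
      G.neighborSet x ⊆ G.neighborSet y ∨ G.neighborSet y ⊆ G.neighborSet x

/-- A chordal bipartite graph: a bipartite graph without induced cycles of length at least `6`. -/
def IsChordalBipartite {V : Type*} (G : SimpleGraph V) : Prop :=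
  G.IsBipartite ∧ ∀ m : ℕ, 6 ≤ m → ¬ (SimpleGraph.cycleGraph m).IsIndContained G

/-- `G` is `H`-free: no induced subgraph of `G` is isomorphic to `H`. -/
def IsIndFree {W V : Type*} (H : SimpleGraph W) (G : SimpleGraph V) : Prop :=
  ¬ H.IsIndContained G

universe u

/-- A class `X` of finite graphs admits an implicit representation: there are a computable
function `D` of two binary words and a constant `c`, both depending on the class only, such that
the vertices of every `n`-vertex graph of the class can be given binary codes of length at most
`c * (log n + 1)`, that is `O(log n)`, from which `D` computes the adjacency of any two
vertices. -/
def AdmitsImplicitRepresentation (X : ∀ V : Type u, SimpleGraph V → Prop) : Prop :=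
  ∃ (D : List Bool → List Bool → Bool) (c : ℕ), Computable₂ D ∧
    ∀ (V : Type u) [Finite V] (G : SimpleGraph V), X V G →
      ∃ code : V → List Bool,
        (∀ v, (code v).length ≤ c * (Nat.log 2 (Nat.card V) + 1)) ∧
        ∀ x y, G.Adj x y ↔ D (code x) (code y) = true

/-! The heart is structural: every nonempty vertex set of such a graph contains, in the subgraph it
induces, twins or a vertex of degree at most a constant `k` depending on `H`
(`exists_twins_or_ncard_le`). Indeed a chordal bipartite graph has a nest vertex
(`exists_isNestVertex`). If no two vertices are twins, the neighbourhoods of its neighbours form a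
strict chain, and a long strict chain gives a large induced half graph, which contains every small
chain graph, in particular `H`.

So the graph can be built up by adding twins and vertices of degree at most `k`. Along the way each
vertex keeps a rank, a position on a line and `k` intervals. A twin is placed next to its original,
so no interval has to be split; a vertex of small degree gets one-point intervals around its
neighbours. These `2 * k + 2` numbers are at most `n`, and written in binary they form the code. -/

theorem cycleGraph_adj_iff_val {m : ℕ} (hm : 2 ≤ m) (u v : Fin m) :
    (SimpleGraph.cycleGraph m).Adj u v ↔
      u.val + 1 = v.val ∨ v.val + 1 = u.val ∨ (u.val = 0 ∧ v.val + 1 = m) ∨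
        (v.val = 0 ∧ u.val + 1 = m) := by
  have key : ∀ a b : Fin m, (a - b).val = 1 ↔
      b.val + 1 = a.val ∨ (a.val = 0 ∧ b.val + 1 = m) := by
    intro a b
    have ha := a.isLt
    have hb := b.isLt
    rw [Fin.val_sub]
    rcases le_or_gt b.val a.val with h | h
    · rw [show m - b.val + a.val = (a.val - b.val) + m by omega, Nat.add_mod_right,
        Nat.mod_eq_of_lt (by omega)]
      omega
    · rw [Nat.mod_eq_of_lt (by omega)]
      omega
  rw [SimpleGraph.cycleGraph_adj', key, key]
  omega

/-! ### Induced paths and long induced cycles. -/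

section

variable {V : Type*} {G : SimpleGraph V}

/-- An induced path `f 0, …, f r` with `2 ≤ r`, closed up by a path `f r, t, z, s, f 0`,
gives an induced cycle. -/
theorem cycleGraph_isIndContained_of_path (f : ℕ → V) (r : ℕ) (hr : 2 ≤ r) (s t z : V)
    (hf : ∀ i ≤ r, ∀ j ≤ r, (G.Adj (f i) (f j) ↔ i + 1 = j ∨ j + 1 = i))
    (hinj : ∀ i ≤ r, ∀ j ≤ r, f i = f j → i = j)
    (hs : ∀ i ≤ r, (G.Adj s (f i) ↔ i = 0)) (ht : ∀ i ≤ r, (G.Adj t (f i) ↔ i = r))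
    (hz : ∀ i ≤ r, ¬ G.Adj z (f i)) (hzs : G.Adj z s) (hzt : G.Adj z t) (hst : ¬ G.Adj s t) :
    (SimpleGraph.cycleGraph (r + 4)).IsIndContained G := by
  let g : ℕ → V := fun i ↦ if i ≤ r then f i else if i = r + 1 then t else if i = r + 2 then z else s
  have g0 : ∀ i ≤ r, g i = f i := fun i hi ↦ by simp [g, hi]
  have g1 : g (r + 1) = t := by simp [g]
  have g2 : g (r + 2) = z := by simp [g]
  have g3 : g (r + 3) = s := by simp [g]
  have cases4 : ∀ i < r + 4, i ≤ r ∨ i = r + 1 ∨ i = r + 2 ∨ i = r + 3 := by omega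
  have hadj : ∀ i < r + 4, ∀ j < r + 4, i ≤ j →
      (G.Adj (g i) (g j) ↔ i + 1 = j ∨ (i = 0 ∧ j + 1 = r + 4)) := by
    intro i hi j hj hij
    rcases cases4 i hi with h | rfl | rfl | rfl <;> rcases cases4 j hj with h' | rfl | rfl | rfl <;>
      try simp only [g1, g2, g3]
    · rw [g0 i h, g0 j h', hf i h j h']; omega
    · rw [g0 i h, G.adj_comm, ht i h]; omega
    · rw [g0 i h, G.adj_comm]; simp only [hz i h, false_iff]; omega
    · rw [g0 i h, G.adj_comm, hs i h, and_true]; omega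
    · omega
    · simp
    · simp [hzt.symm]
    · rw [G.adj_comm]; simp [hst]
    · omega
    · omega
    · simp
    · simp [hzs]
    · omega
    · omega
    · omega
    · simp
  have hginj : ∀ i < r + 4, ∀ j < r + 4, i ≤ j → g i = g j → i = j := by
    intro i hi j hj hij h
    by_contra hne
    have e1 := ht 0 (by omega)
    have e2 := ht r le_rfl
    have e3 := hs r le_rfl
    rcases cases4 i hi with h1 | rfl | rfl | rfl <;> rcases cases4 j hj with h' | rfl | rfl | rfl <;>
      (try simp only [g1, g2, g3] at h) <;> first | omega | skip
    · rw [g0 i h1, g0 j h'] at h; exact hne (hinj i h1 j h' h)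
    · rw [g0 i h1] at h; exact hz i h1 (h ▸ hzt)
    · rw [g0 i h1] at h
      have a1 := (ht i h1).1 (h ▸ hzt.symm)
      have a2 := (hs i h1).1 (h ▸ hzs.symm)
      omega
    · rw [g0 i h1] at h; exact hz i h1 (h ▸ hzs)
    · exact G.loopless.irrefl _ (h ▸ hzt)
    · rw [h] at e2; have := e3.1 (e2.2 rfl); omega
    · exact G.loopless.irrefl _ (h ▸ hzs)
  refine ⟨⟨⟨fun i ↦ g i.val, fun i j h ↦ ?_⟩, fun {i j} ↦ ?_⟩⟩
  · rcases le_total i.val j.val with hij | hij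
    · exact Fin.ext (hginj _ i.isLt _ j.isLt hij h)
    · exact Fin.ext (hginj _ j.isLt _ i.isLt hij h.symm).symm
  · rw [cycleGraph_adj_iff_val (by omega)]
    change G.Adj (g i.val) (g j.val) ↔ _
    rcases le_total i.val j.val with hij | hij
    · rw [hadj _ i.isLt _ j.isLt hij]; omega
    · rw [G.adj_comm, hadj _ j.isLt _ i.isLt hij]; omega

/-- In a bipartite graph without long induced cycles, two vertices `s`, `t` with a common
neighbour `z` cannot be attached to the two ends of an induced path avoiding `z`, if `t` sees
only the last vertex of the path and `s` does not see it. -/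
theorem not_path_of_no_hole {A B : Set V} (hAB : G.IsBipartiteWith A B)
    (hG : ∀ m : ℕ, 6 ≤ m → ¬ (SimpleGraph.cycleGraph m).IsIndContained G)
    (f : ℕ → V) (r : ℕ) (s t z : V)
    (hf : ∀ i ≤ r, ∀ j ≤ r, (G.Adj (f i) (f j) ↔ i + 1 = j ∨ j + 1 = i))
    (hinj : ∀ i ≤ r, ∀ j ≤ r, f i = f j → i = j)
    (hs0 : G.Adj s (f 0)) (hsr : ¬ G.Adj s (f r)) (ht : ∀ i ≤ r, (G.Adj t (f i) ↔ i = r))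
    (hz : ∀ i ≤ r, ¬ G.Adj z (f i)) (hzB : z ∈ B) (hzs : G.Adj z s) (hzt : G.Adj z t) : False := by
  classical
  have hsA : s ∈ A := hAB.symm.mem_of_mem_adj hzB hzs
  have htA : t ∈ A := hAB.symm.mem_of_mem_adj hzB hzt
  have notA : ∀ v, v ∈ A → v ∈ B → False := fun v h h' ↦ Set.disjoint_left.1 hAB.disjoint h h'
  -- Cutting the path at the last vertex seen by `s` leaves a path whose first vertex alone is seen
  -- by `s`.
  let j := Nat.findGreatest (fun i ↦ G.Adj s (f i)) r
  have hjs : G.Adj s (f j) :=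
    Nat.findGreatest_spec (P := fun i ↦ G.Adj s (f i)) (Nat.zero_le r) hs0
  have hjr : j ≤ r := Nat.findGreatest_le r
  have hjmax : ∀ i, j < i → i ≤ r → ¬ G.Adj s (f i) := fun i h h' ↦
    Nat.findGreatest_is_greatest (P := fun i ↦ G.Adj s (f i)) h h'
  have hne : j ≠ r := fun h ↦ hsr (h ▸ hjs)
  -- `f j` and `f r` lie in the same part, hence are not adjacent; the remaining path has at least
  -- two edges and the cycle has length at least 6.
  have hne1 : j + 1 ≠ r := by
    intro h
    have h1 : G.Adj (f j) (f r) := (hf j hjr r le_rfl).2 (Or.inl h)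
    have h2 : f j ∈ B := hAB.mem_of_mem_adj hsA hjs
    have h3 : f r ∈ B := hAB.mem_of_mem_adj htA ((ht r le_rfl).2 rfl)
    exact notA _ (hAB.symm.mem_of_mem_adj h2 h1) h3
  refine hG (r - j + 4) (by omega) (cycleGraph_isIndContained_of_path (fun i ↦ f (j + i)) (r - j)
    (by omega) s t z ?_ ?_ ?_ ?_ ?_ hzs hzt ?_)
  · intro a ha b hb
    rw [hf _ (by omega) _ (by omega)]; omega
  · intro a ha b hb h
    have := hinj _ (by omega) _ (by omega) h
    omega
  · intro i hi
    rcases Nat.eq_zero_or_pos i with rfl | h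
    · simpa using hjs
    · simp only [hjmax (j + i) (by omega) (by omega), false_iff]; omega
  · intro i hi
    rw [ht _ (by omega)]; omega
  · exact fun i hi ↦ hz _ (by omega)
  · exact fun h ↦ notA _ htA (hAB.mem_of_mem_adj hsA h)

/-- A shortest walk is an induced path. -/
theorem exists_induced_path {R : SimpleGraph V} {u v : V} (h : R.Reachable u v) :
    ∃ f : ℕ → V, f 0 = u ∧ f (R.dist u v) = v ∧
      (∀ i ≤ R.dist u v, R.dist u (f i) = i ∧ R.Reachable u (f i)) ∧
      (∀ i ≤ R.dist u v, ∀ j ≤ R.dist u v, (R.Adj (f i) (f j) ↔ i + 1 = j ∨ j + 1 = i)) := by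
  obtain ⟨p, hp⟩ := h.exists_walk_length_eq_dist
  have hd : ∀ i ≤ R.dist u v, R.dist u (p.getVert i) = i := by
    intro i hi
    have h1 : R.dist u (p.getVert i) ≤ i := by
      refine (SimpleGraph.dist_le (p.take i)).trans ?_
      simp [SimpleGraph.Walk.take_length]
    have h2 : R.dist (p.getVert i) v ≤ R.dist u v - i := by
      refine (SimpleGraph.dist_le (p.drop i)).trans ?_
      simp [SimpleGraph.Walk.drop_length, hp]
    have h3 := SimpleGraph.Reachable.dist_triangle_left (p.take i).reachable v
    omega
  refine ⟨p.getVert, by simp, by simp [← hp], fun i hi ↦ ⟨hd i hi, (p.take i).reachable⟩, ?_⟩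
  have hadj : ∀ i < R.dist u v, R.Adj (p.getVert i) (p.getVert (i + 1)) :=
    fun i hi ↦ p.adj_getVert_succ (hp ▸ hi)
  intro i hi j hj
  constructor
  · intro h'
    have h1 := hd i hi
    have h2 := hd j hj
    have := SimpleGraph.Adj.diff_dist_adj (u := u) h'
    have hij : i ≠ j := by
      rintro rfl
      exact R.loopless.irrefl _ h'
    omega
  · rintro (rfl | rfl)
    · exact hadj i (by omega)
    · exact (hadj j (by omega)).symm


/-! ### Existence of nest vertices. -/

/-- The vertex `x` is a nest vertex relative to `X` and `Y`: the neighbourhoods in `X` of its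
neighbours in `Y` are linearly ordered by inclusion. -/
def IsNestVertex (G : SimpleGraph V) (X Y : Set V) (x : V) : Prop :=
  ∀ y₁ ∈ Y, ∀ y₂ ∈ Y, G.Adj x y₁ → G.Adj x y₂ →
    (∀ z ∈ X, G.Adj z y₁ → G.Adj z y₂) ∨ (∀ z ∈ X, G.Adj z y₂ → G.Adj z y₁)

/-- In a chordal bipartite graph, any vertex `y₀` of one part which does not see all of the other
part misses some nest vertex. -/
theorem exists_isNestVertex [Finite V] {A B : Set V} (hAB : G.IsBipartiteWith A B)
    (hG : ∀ m : ℕ, 6 ≤ m → ¬ (SimpleGraph.cycleGraph m).IsIndContained G) (Y : Set V) :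
    ∀ X : Set V, X ⊆ A → Y ⊆ B → ∀ y₀ ∈ Y, ∀ c ∈ X, ¬ G.Adj c y₀ →
      ∃ x ∈ X, ¬ G.Adj x y₀ ∧ IsNestVertex G X Y x := by
  induction Y using WellFoundedLT.induction with
  | ind Y ih =>
  intro X hXA hYB y₀ hy₀ c hc hcy₀
  have notAB : ∀ v, v ∈ A → v ∈ B → False := fun v h h' ↦ Set.disjoint_left.1 hAB.disjoint h h'
  -- Remove `y₀` and its neighbours and consider the component of `c`. `YC` is its trace on `Y`;
  -- `X'` is its trace on `X` together with all neighbours of `YC` in `X`, so neighbourhoods of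
  -- vertices of `YC` may be compared inside `X'`.
  let U : Set V := {v | (v ∈ X ∧ ¬ G.Adj v y₀) ∨ (v ∈ Y ∧ v ≠ y₀)}
  let R : SimpleGraph V :=
    { Adj := fun a b ↦ G.Adj a b ∧ a ∈ U ∧ b ∈ U
      symm := ⟨fun a b h ↦ ⟨h.1.symm, h.2.2, h.2.1⟩⟩
      loopless := ⟨fun a h ↦ G.loopless.irrefl a h.1⟩ }
  have hUX : ∀ v ∈ X, ¬ G.Adj v y₀ → v ∈ U := fun v h h' ↦ Or.inl ⟨h, h'⟩
  have hUY : ∀ v ∈ Y, v ≠ y₀ → v ∈ U := fun v h h' ↦ Or.inr ⟨h, h'⟩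
  have hUB : ∀ v ∈ U, v ∈ B → v ∈ Y ∧ v ≠ y₀ := by
    rintro v (h | h) h'
    · exact (notAB v (hXA h.1) h').elim
    · exact h
  have hcU : c ∈ U := hUX c hc hcy₀
  have reach_mem : ∀ a b, a ∈ U → R.Reachable a b → b ∈ U := by
    rintro a b ha ⟨p⟩
    induction p with
    | nil => exact ha
    | cons h _ ih => exact ih h.2.2
  let YC : Set V := {y | y ∈ Y ∧ y ≠ y₀ ∧ R.Reachable c y}
  let X' : Set V := {x | x ∈ X ∧ ((¬ G.Adj x y₀ ∧ R.Reachable c x) ∨ ∃ y ∈ YC, G.Adj x y)}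
  have hYCY : YC ⊆ Y := fun y h ↦ h.1
  have hX'X : X' ⊆ X := fun x h ↦ h.1
  have hcX' : c ∈ X' := ⟨hc, Or.inl ⟨hcy₀, .refl _⟩⟩
  have hreach : ∀ x ∈ X', ¬ G.Adj x y₀ → R.Reachable c x := by
    rintro x ⟨hx, h | ⟨y, hy, hxy⟩⟩ hxy₀
    · exact h.2
    · exact hy.2.2.trans
        (SimpleGraph.Adj.reachable ⟨hxy.symm, hUY y hy.1 hy.2.1, hUX x hx hxy₀⟩)
  have hnbr : ∀ x ∈ X', ¬ G.Adj x y₀ → ∀ y ∈ Y, G.Adj x y → y ∈ YC := by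
    intro x hx hxy₀ y hy hxy
    have hne : y ≠ y₀ := by rintro rfl; exact hxy₀ hxy
    exact ⟨hy, hne, (hreach x hx hxy₀).trans
      (SimpleGraph.Adj.reachable ⟨hxy, hUX x hx.1 hxy₀, hUY y hy hne⟩)⟩
  have hback : ∀ y ∈ YC, ∀ z ∈ X, G.Adj z y → z ∈ X' := fun y hy z hz h ↦ ⟨hz, Or.inr ⟨y, hy, h⟩⟩
  rcases YC.eq_empty_or_nonempty with hYC | hYC
  · refine ⟨c, hc, hcy₀, fun y₁ h₁ _ _ h _ ↦ ?_⟩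
    have := hnbr c hcX' hcy₀ y₁ h₁ h
    rw [hYC] at this
    exact this.elim
  obtain ⟨y, hy, hymax⟩ :=
    Set.exists_max_image YC (fun y ↦ {s | s ∈ X ∧ G.Adj s y₀ ∧ G.Adj s y}.ncard) YC.toFinite hYC
  -- If `t` sees `y₀` but not `y`, take its neighbour `q` in `YC` nearest to `y`. By maximality of
  -- `y`, some `s` sees `y₀` and `y` but not `q`; a shortest path from `y` to `q`, closed through
  -- `t`, `y₀`, `s`, yields a hole.
  have cover : ∀ t ∈ X', G.Adj t y₀ → G.Adj t y := by
    intro t ht hty₀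
    by_contra hty
    have hQ : {q | q ∈ YC ∧ G.Adj t q}.Nonempty := by
      rcases ht.2 with h | ⟨q, hq, h⟩
      · exact (h.1 hty₀).elim
      · exact ⟨q, hq, h⟩
    obtain ⟨q, ⟨hq, htq⟩, hqmin⟩ :=
      Set.exists_min_image {q | q ∈ YC ∧ G.Adj t q} (fun q ↦ R.dist y q) (Set.toFinite _) hQ
    obtain ⟨s, hsX, hsy₀, hsy, hsq⟩ : ∃ s ∈ X, G.Adj s y₀ ∧ G.Adj s y ∧ ¬ G.Adj s q := by
      by_contra! hcon
      have hlt : {s | s ∈ X ∧ G.Adj s y₀ ∧ G.Adj s y} ⊂ {s | s ∈ X ∧ G.Adj s y₀ ∧ G.Adj s q} := by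
        refine ⟨fun s h ↦ ⟨h.1, h.2.1, hcon s h.1 h.2.1 h.2.2⟩, fun h ↦ hty ?_⟩
        exact (h ⟨ht.1, hty₀, htq⟩ : t ∈ {s | s ∈ X ∧ G.Adj s y₀ ∧ G.Adj s y}).2.2
      exact absurd (hymax q hq) (not_le.2 (Set.ncard_lt_ncard hlt (Set.toFinite _)))
    have hyU : y ∈ U := hUY y hy.1 hy.2.1
    obtain ⟨f, f0, fr, hfd, hfa⟩ := exists_induced_path (hy.2.2.symm.trans hq.2.2)
    have hfU : ∀ i ≤ R.dist y q, f i ∈ U := fun i hi ↦ reach_mem y _ hyU (hfd i hi).2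
    refine not_path_of_no_hole hAB hG f (R.dist y q) s t y₀ ?_ ?_ (f0 ▸ hsy) (by rwa [fr]) ?_ ?_
      (hYB hy₀) hsy₀.symm hty₀.symm
    · intro i hi j hj
      rw [← hfa i hi j hj]
      exact ⟨fun h ↦ ⟨h, hfU i hi, hfU j hj⟩, fun h ↦ h.1⟩
    · intro i hi j hj h
      rw [← (hfd i hi).1, ← (hfd j hj).1, h]
    · intro i hi
      constructor
      · intro h
        have hiB := hUB _ (hfU i hi) (hAB.mem_of_mem_adj (hXA ht.1) h)
        have := hqmin (f i) ⟨⟨hiB.1, hiB.2, hy.2.2.trans (hfd i hi).2⟩, h⟩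
        simp only [(hfd i hi).1] at this
        omega
      · rintro rfl
        rwa [fr]
    · intro i hi h
      rcases hfU i hi with h' | h'
      · exact h'.2 h.symm
      · exact notAB _ (hAB.symm.mem_of_mem_adj (hYB hy₀) h) (hYB h'.1)
  have hYClt : YC < Y := ⟨hYCY, fun h ↦ (h hy₀).2.1 rfl⟩
  by_cases hfull : ∀ x ∈ X', G.Adj x y
  -- Here the neighbourhood of `y` in `X'` is everything, so `y` is comparable with all of `YC` and
  -- can be dropped.
  · have hlt : insert y₀ (YC \ {y}) < Y := by
      refine ⟨Set.insert_subset hy₀ (Set.sdiff_subset.trans hYCY), fun h ↦ ?_⟩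
      rcases h hy.1 with h | h
      · exact hy.2.1 h
      · exact h.2 rfl
    obtain ⟨x, hx, hxy₀, hnest⟩ :=
      ih _ hlt X' (hX'X.trans hXA) (hlt.le.trans hYB) y₀ (Set.mem_insert _ _) c hcX' hcy₀
    refine ⟨x, hX'X hx, hxy₀, fun y₁ h₁ y₂ h₂ a₁ a₂ ↦ ?_⟩
    have m₁ := hnbr x hx hxy₀ y₁ h₁ a₁
    have m₂ := hnbr x hx hxy₀ y₂ h₂ a₂
    by_cases e₁ : y₁ = y
    · exact Or.inr fun z hz h ↦ e₁ ▸ hfull z (hback y₂ m₂ z hz h)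
    by_cases e₂ : y₂ = y
    · exact Or.inl fun z hz h ↦ e₂ ▸ hfull z (hback y₁ m₁ z hz h)
    exact (hnest y₁ (Or.inr ⟨m₁, e₁⟩) y₂ (Or.inr ⟨m₂, e₂⟩) a₁ a₂).imp
      (fun H z hz h ↦ H z (hback y₁ m₁ z hz h) h) (fun H z hz h ↦ H z (hback y₂ m₂ z hz h) h)
  · push Not at hfull
    obtain ⟨x₁, hx₁, hx₁y⟩ := hfull
    -- Now `y` takes the role of `y₀`: a vertex of `X'` missing `y` also misses `y₀`, by `cover`, so
    -- its neighbours in `Y` all lie in `YC`.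
    obtain ⟨x, hx, hxy, hnest⟩ :=
      ih _ hYClt X' (hX'X.trans hXA) (hYCY.trans hYB) y hy x₁ hx₁ hx₁y
    have hxy₀ : ¬ G.Adj x y₀ := fun h ↦ hxy (cover x hx h)
    refine ⟨x, hX'X hx, hxy₀, fun y₁ h₁ y₂ h₂ a₁ a₂ ↦ ?_⟩
    have m₁ := hnbr x hx hxy₀ y₁ h₁ a₁
    have m₂ := hnbr x hx hxy₀ y₂ h₂ a₂
    exact (hnest y₁ m₁ y₂ m₂ a₁ a₂).imp
      (fun H z hz h ↦ H z (hback y₁ m₁ z hz h) h) (fun H z hz h ↦ H z (hback y₂ m₂ z hz h) h)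

end

/-! ### Half graphs, twins and bounded degree. -/

section

variable {V : Type*} {G : SimpleGraph V}

/-- A chain graph is an induced subgraph of every graph with a sufficiently large
induced half graph. -/
theorem IsChainGraph.isIndContained_of_halfGraph {W : Type*} [Finite W] {H : SimpleGraph W}
    (hH : IsChainGraph H) {A B : Set V} (hAB : G.IsBipartiteWith A B) {n : ℕ}
    (hn : (Nat.card W + 2) * (2 * Nat.card W) ≤ n) (a b : Fin n → V)
    (ha : ∀ i, a i ∈ A) (hb : ∀ i, b i ∈ B) (hadj : ∀ i j, G.Adj (a i) (b j) ↔ i ≤ j) :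
    H.IsIndContained G := by
  classical
  obtain ⟨C, D, hCD, hbip, hchain⟩ := hH
  set N := Nat.card W
  have notAB : ∀ v, v ∈ A → v ∈ B → False := fun v h h' ↦ Set.disjoint_left.1 hAB.disjoint h h'
  have hainj : ∀ i j, a i = a j → i = j := fun i j h ↦
    le_antisymm ((hadj i j).1 (h ▸ (hadj j j).2 le_rfl)) ((hadj j i).1 (h ▸ (hadj i i).2 le_rfl))
  have hbinj : ∀ i j, b i = b j → i = j := fun i j h ↦
    le_antisymm ((hadj i j).1 (h ▸ (hadj i i).2 le_rfl)) ((hadj j i).1 (h ▸ (hadj j j).2 le_rfl))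
  let e : W ≃ Fin N := Finite.equivFin W
  have hdeg : ∀ x, (H.neighborSet x).ncard ≤ N := fun x ↦ Set.ncard_le_card _
  -- `θ y` is the least number such that the neighbours of `y` are the vertices of degree `≥ θ y`
  have hθ : ∀ y, ∃ t ≤ N + 1, y ∈ D → ∀ x ∈ C, (H.Adj x y ↔ t ≤ (H.neighborSet x).ncard) := by
    intro y
    by_cases hne : {x | x ∈ C ∧ H.Adj x y}.Nonempty
    · obtain ⟨x₀, ⟨hx₀, h₀⟩, hmin⟩ := Set.exists_min_image {x | x ∈ C ∧ H.Adj x y}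
        (fun x ↦ (H.neighborSet x).ncard) (Set.toFinite _) hne
      refine ⟨_, (hdeg x₀).trans (Nat.le_succ _), fun hy x hx ↦ ⟨fun h ↦ hmin x ⟨hx, h⟩, fun h ↦ ?_⟩⟩
      rcases hchain x₀ hx₀ x hx with h' | h'
      · exact h' h₀
      · have hy' : y ∈ H.neighborSet x₀ := h₀
        rw [← Set.eq_of_subset_of_ncard_le h' h (Set.toFinite _)] at hy'
        exact hy'
    -- Without neighbours, the threshold `N + 1` exceeds every degree.
    · refine ⟨N + 1, le_rfl, fun hy x hx ↦ ⟨fun h ↦ (hne ⟨x, hx, h⟩).elim, fun h ↦ ?_⟩⟩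
      have := hdeg x
      omega
  choose θ hθN hθ using hθ
  have bound : ∀ q l : ℕ, q ≤ N + 1 → l < 2 * N → q * (2 * N) + l < n := by
    intro q l hq hl
    have : q * (2 * N) ≤ (N + 1) * (2 * N) := Nat.mul_le_mul_right _ hq
    nlinarith
  have order : ∀ q q' l l' : ℕ, l < N → l' < N →
      (q * (2 * N) + l ≤ q' * (2 * N) + (N + l') ↔ q ≤ q') := by
    intro q q' l l' hl hl'
    constructor
    · intro h
      by_contra hlt
      have : (q' + 1) * (2 * N) ≤ q * (2 * N) := Nat.mul_le_mul_right _ (by omega)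
      nlinarith
    · intro h
      have : q * (2 * N) ≤ q' * (2 * N) := Nat.mul_le_mul_right _ h
      omega
  have inj : ∀ q q' l l' : ℕ, l < 2 * N → l' < 2 * N →
      q * (2 * N) + l = q' * (2 * N) + l' → l = l' := by
    intro q q' l l' hl hl' h
    have := congrArg (· % (2 * N)) h
    simpa [Nat.mul_add_mod', Nat.mod_eq_of_lt hl, Nat.mod_eq_of_lt hl'] using this
  have he : ∀ w, (e w).val < 2 * N := fun w ↦ by have := (e w).isLt; omega
  have he' : ∀ w, N + (e w).val < 2 * N := fun w ↦ by have := (e w).isLt; omega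
  -- The half graph is cut into `N + 2` blocks of length `2 * N`. Vertices of `C` use the first half
  -- of a block and vertices of `D` the second, so within one block the pair is adjacent; larger
  -- degrees go to earlier blocks, and `e` keeps the indices distinct.
  let r : W → Fin n := fun x ↦
    ⟨(N + 1 - (H.neighborSet x).ncard) * (2 * N) + (e x).val, bound _ _ (by omega) (he x)⟩
  let s : W → Fin n := fun y ↦
    ⟨(N + 1 - θ y) * (2 * N) + (N + (e y).val), bound _ _ (by omega) (he' y)⟩
  have hrs : ∀ x ∈ C, ∀ y ∈ D, (G.Adj (a (r x)) (b (s y)) ↔ H.Adj x y) := by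
    intro x hx y hy
    rw [hadj, hθ y hy x hx, Fin.le_def]
    simp only [r, s]
    rw [order _ _ _ _ (e x).isLt (e y).isLt]
    have := hθN y
    have := hdeg x
    omega
  have hD : ∀ x, x ∉ C → x ∈ D := fun x hx ↦ by
    have : x ∈ C ∪ D := hCD ▸ Set.mem_univ x
    exact this.resolve_left hx
  have notCD : ∀ v, v ∈ C → v ∈ D → False := fun v h h' ↦ Set.disjoint_left.1 hbip.disjoint h h'
  refine ⟨⟨⟨fun x ↦ if x ∈ C then a (r x) else b (s x), fun x y h ↦ ?_⟩, fun {x y} ↦ ?_⟩⟩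
  · by_cases hx : x ∈ C <;> by_cases hy : y ∈ C <;> simp only [hx, hy, if_true, if_false] at h
    · have := inj _ _ _ _ (he x) (he y) (congrArg Fin.val (hainj _ _ h))
      exact e.injective (Fin.ext this)
    · exact (notAB _ (ha _) (h ▸ hb _)).elim
    · exact (notAB _ (ha _) (h ▸ hb _)).elim
    · have := inj _ _ _ _ (he' x) (he' y) (congrArg Fin.val (hbinj _ _ h))
      exact e.injective (Fin.ext (Nat.add_left_cancel this))
  · change G.Adj (if x ∈ C then a (r x) else b (s x)) (if y ∈ C then a (r y) else b (s y)) ↔ _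
    by_cases hx : x ∈ C <;> by_cases hy : y ∈ C <;> simp only [hx, hy, if_true, if_false]
    · refine iff_of_false (fun h ↦ ?_) fun h ↦ ?_
      · exact notAB _ (ha _) (hAB.mem_of_mem_adj (ha _) h)
      · exact notCD _ hy (hbip.mem_of_mem_adj hx h)
    · exact hrs x hx y (hD y hy)
    · rw [G.adj_comm, H.adj_comm]
      exact hrs y hy x (hD x hx)
    · refine iff_of_false (fun h ↦ ?_) fun h ↦ ?_
      · exact notAB _ (hAB.symm.mem_of_mem_adj (hb _) h) (hb _)
      · exact hy (hbip.symm.mem_of_mem_adj (hD x hx) h)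

/-- A nest vertex with `n + 1` pairwise non-twin neighbours yields an induced half graph. -/
theorem IsNestVertex.exists_halfGraph [Finite V] {X Y : Set V} {v : V} (h : IsNestVertex G X Y v)
    (htwin : ∀ y₁ ∈ Y, ∀ y₂ ∈ Y, (∀ z ∈ X, (G.Adj z y₁ ↔ G.Adj z y₂)) → y₁ = y₂)
    {n : ℕ} (hn : n < {y | y ∈ Y ∧ G.Adj v y}.ncard) :
    ∃ a b : Fin n → V, (∀ i, a i ∈ X) ∧ (∀ i, b i ∈ Y) ∧ ∀ i j, G.Adj (a i) (b j) ↔ i ≤ j := by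
  classical
  set T := {y | y ∈ Y ∧ G.Adj v y}
  -- On a chain of neighbourhoods, comparing sizes amounts to comparing sets.
  let c : V → ℕ := fun y ↦ {z | z ∈ X ∧ G.Adj z y}.ncard
  have mono : ∀ y₁ ∈ T, ∀ y₂ ∈ T, c y₁ ≤ c y₂ → ∀ z ∈ X, G.Adj z y₁ → G.Adj z y₂ := by
    intro y₁ h₁ y₂ h₂ hle z hz hzy
    rcases h y₁ h₁.1 y₂ h₂.1 h₁.2 h₂.2 with H | H
    · exact H z hz hzy
    · have hsub : {z | z ∈ X ∧ G.Adj z y₂} ⊆ {z | z ∈ X ∧ G.Adj z y₁} :=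
        fun z hz ↦ ⟨hz.1, H z hz.1 hz.2⟩
      have := Set.eq_of_subset_of_ncard_le hsub hle (Set.toFinite _)
      have hz' : z ∈ {z | z ∈ X ∧ G.Adj z y₁} := ⟨hz, hzy⟩
      rw [← this] at hz'
      exact hz'.2
  have cinj : Set.InjOn c T := fun y₁ h₁ y₂ h₂ he ↦ htwin y₁ h₁.1 y₂ h₂.1
    fun z hz ↦ ⟨mono y₁ h₁ y₂ h₂ he.le z hz, mono y₂ h₂ y₁ h₁ he.ge z hz⟩
  have hcard : n + 1 ≤ ((c '' T).toFinite.toFinset).card := by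
    rw [← Set.ncard_eq_toFinset_card (c '' T) (Set.toFinite _), cinj.ncard_image]
    exact hn
  obtain ⟨S, hS, hScard⟩ := Finset.exists_subset_card_eq hcard
  have hβ : ∀ i : Fin (n + 1), ∃ y ∈ T, c y = S.orderEmbOfFin hScard i := by
    intro i
    have := hS (S.orderEmbOfFin_mem hScard i)
    simpa using this
  choose β hβT hβc using hβ
  have hβmono : ∀ i j, i < j → c (β i) < c (β j) := fun i j hij ↦ by
    rw [hβc, hβc]
    exact (S.orderEmbOfFin hScard).strictMono hij
  -- The `n + 1` distinct neighbourhoods have `n` consecutive gaps; a witness from each gap gives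
  -- the other side of the half graph.
  have hα : ∀ i : Fin n, ∃ z ∈ X, G.Adj z (β i.succ) ∧ ¬ G.Adj z (β i.castSucc) := by
    intro i
    by_contra! hcon
    have hlt := hβmono _ _ (Fin.castSucc_lt_succ (i := i))
    refine absurd hlt (not_lt.2 (Set.ncard_le_ncard (fun z hz ↦ ⟨hz.1, hcon z hz.1 hz.2⟩)
      (Set.toFinite _)))
  choose α hαX hα hα' using hα
  refine ⟨α, fun j ↦ β j.succ, hαX, fun j ↦ (hβT _).1, fun i j ↦ ⟨fun hij ↦ ?_, fun hij ↦ ?_⟩⟩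
  · by_contra hlt
    refine hα' i (mono _ (hβT j.succ) _ (hβT i.castSucc) ?_ _ (hαX i) hij)
    rcases (show j.succ ≤ i.castSucc from by
      rw [Fin.le_def]; simp only [Fin.val_succ, Fin.val_castSucc]; omega).eq_or_lt with h' | h'
    · rw [h']
    · exact (hβmono _ _ h').le
  · refine mono _ (hβT i.succ) _ (hβT j.succ) ?_ _ (hαX i) (hα i)
    rcases hij.eq_or_lt with h' | h'
    · rw [h']
    · exact (hβmono _ _ (Fin.succ_lt_succ_iff.2 h')).le

/-- In every induced subgraph of a chordal bipartite graph without large induced half graphs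
there are two twins or a vertex of bounded degree. -/
theorem exists_twins_or_ncard_le {W : Type*} [Finite W] {H : SimpleGraph W} (hH : IsChainGraph H)
    [Finite V] (hG : IsChordalBipartite G) (hfree : IsIndFree H G) (S : Set V)
    (hS : S.Nonempty) :
    (∃ u ∈ S, ∃ v ∈ S, u ≠ v ∧ ∀ z ∈ S, (G.Adj z u ↔ G.Adj z v)) ∨
      ∃ v ∈ S, {y | y ∈ S ∧ G.Adj v y}.ncard ≤ (Nat.card W + 2) * (2 * Nat.card W) := by
  obtain ⟨hbip, hhole⟩ := hG
  obtain ⟨A, B, hAB⟩ := SimpleGraph.isBipartite_iff_exists_isBipartiteWith.1 hbip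
  by_contra! hcon
  obtain ⟨htwin, hdeg⟩ := hcon
  -- an arbitrary vertex has positive degree, so that both parts are nonempty
  obtain ⟨v, hv⟩ := hS
  have hne : ∃ x ∈ A ∩ S, True := by
    have hpos : {y | y ∈ S ∧ G.Adj v y}.Nonempty :=
      Set.nonempty_of_ncard_ne_zero (by have := hdeg v hv; omega)
    obtain ⟨w, hwS, hvw⟩ := hpos
    rcases hAB.mem_of_adj hvw with h | h
    · exact ⟨v, ⟨h.1, hv⟩, trivial⟩
    · exact ⟨w, ⟨h.2, hwS⟩, trivial⟩
  have hnest : ∃ x ∈ A ∩ S, IsNestVertex G (A ∩ S) (B ∩ S) x := by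
    by_cases hfull : ∀ x ∈ A ∩ S, ∀ y ∈ B ∩ S, G.Adj x y
    · obtain ⟨x, hx, -⟩ := hne
      exact ⟨x, hx, fun y₁ _ y₂ h₂ _ _ ↦ Or.inl fun z hz _ ↦ hfull z hz y₂ h₂⟩
    · push Not at hfull
      obtain ⟨c, hc, y₀, hy₀, hcy⟩ := hfull
      obtain ⟨x, hx, -, h⟩ := exists_isNestVertex hAB hhole (B ∩ S) (A ∩ S) Set.inter_subset_left
        Set.inter_subset_left y₀ hy₀ c hc hcy
      exact ⟨x, hx, h⟩
  obtain ⟨x, hx, hnest⟩ := hnest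
  have heq : {y | y ∈ S ∧ G.Adj x y} = {y | y ∈ B ∩ S ∧ G.Adj x y} :=
    Set.ext fun y ↦ ⟨fun h ↦ ⟨⟨hAB.mem_of_mem_adj hx.1 h.2, h.1⟩, h.2⟩, fun h ↦ ⟨h.1.2, h.2⟩⟩
  obtain ⟨a, b, ha, hb, hab⟩ := hnest.exists_halfGraph (fun y₁ h₁ y₂ h₂ heq ↦ by
    by_contra hne
    obtain ⟨z, hz, h⟩ := htwin y₁ h₁.2 y₂ h₂.2 hne
    have hzA : z ∈ A := by
      rcases h with h | h
      · exact hAB.mem_of_mem_adj' h₁.1 h.1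
      · exact hAB.mem_of_mem_adj' h₂.1 h.2
    have := heq z ⟨hzA, hz⟩
    tauto) (heq ▸ hdeg x hx.2)
  exact hfree (hH.isIndContained_of_halfGraph hAB le_rfl a b (fun i ↦ (ha i).1)
    (fun i ↦ (hb i).1) hab)

end

/-! ### Interval models. -/

section

variable {V : Type*} {G : SimpleGraph V}

/-- Every vertex of `S` has a rank, a position and `k` half-open intervals of positions, all bounded
by the size of `S`; two vertices are adjacent if and only if the one of larger rank has its position
in one of the intervals of the one of smaller rank. -/
def HasIntervalModel (G : SimpleGraph V) (k : ℕ) (S : Set V) : Prop :=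
  ∃ (d p : V → ℕ) (l r : V → Fin k → ℕ),
    (∀ x ∈ S, d x ≤ S.ncard ∧ p x < S.ncard ∧ ∀ i, l x i ≤ S.ncard ∧ r x i ≤ S.ncard) ∧
    Set.InjOn p S ∧
    ∀ x ∈ S, ∀ y ∈ S, (G.Adj x y ↔
      (d x < d y ∧ ∃ i, l x i ≤ p y ∧ p y < r x i) ∨ (d y < d x ∧ ∃ i, l y i ≤ p x ∧ p x < r y i))

/-- Adding a vertex of small degree to an interval model. -/
theorem HasIntervalModel.insert_of_ncard_le [Finite V] {k : ℕ} {S : Set V} {v : V} (hv : v ∉ S)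
    (hS : HasIntervalModel G k S) (hdeg : {y | y ∈ S ∧ G.Adj v y}.ncard ≤ k) :
    HasIntervalModel G k (insert v S) := by
  classical
  obtain ⟨d, p, l, r, hb, hp, hadj⟩ := hS
  obtain ⟨g, hg⟩ : ∃ g : Fin k → ℕ × ℕ, (∀ i, (g i).1 ≤ S.ncard ∧ (g i).2 ≤ S.ncard) ∧
      ∀ y ∈ S, (G.Adj v y ↔ ∃ i, (g i).1 ≤ p y ∧ p y < (g i).2) := by
    let T := {y | y ∈ S ∧ G.Adj v y}
    let e : T ≃ Fin T.ncard := Finite.equivFinOfCardEq (Nat.card_coe_set_eq T)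
    let g : Fin k → ℕ × ℕ := fun i ↦
      if h : i.val < T.ncard then (p (e.symm ⟨i, h⟩), p (e.symm ⟨i, h⟩) + 1) else (0, 0)
    have g1 : ∀ (i : Fin k) (h : i.val < T.ncard),
        g i = (p (e.symm ⟨i, h⟩), p (e.symm ⟨i, h⟩) + 1) := fun i h ↦ dif_pos h
    have g2 : ∀ (i : Fin k), ¬ i.val < T.ncard → g i = (0, 0) := fun i h ↦ dif_neg h
    refine ⟨g, fun i ↦ ?_, fun y hy ↦ ⟨fun h ↦ ?_, ?_⟩⟩
    · by_cases h : i.val < T.ncard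
      · rw [g1 i h]
        have := (hb _ (e.symm ⟨i, h⟩).2.1).2.1
        exact ⟨this.le, this⟩
      · simp [g2 i h]
    · refine ⟨⟨(e ⟨y, hy, h⟩).val, (e ⟨y, hy, h⟩).isLt.trans_le hdeg⟩, ?_⟩
      rw [g1 _ (e ⟨y, hy, h⟩).isLt]
      have : e.symm ⟨(e ⟨y, hy, h⟩).val, (e ⟨y, hy, h⟩).isLt⟩ = ⟨y, hy, h⟩ :=
        e.symm_apply_apply _
      simp only [this]
      omega
    · rintro ⟨i, h⟩
      by_cases hi : i.val < T.ncard
      · rw [g1 i hi] at h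
        have hmem := (e.symm ⟨i, hi⟩).2
        have : p y = p (e.symm ⟨i, hi⟩) := by simp only at h; omega
        rw [hp hy hmem.1 this]
        exact hmem.2
      · simp [g2 i hi] at h
  have hcard : (insert v S).ncard = S.ncard + 1 := Set.ncard_insert_of_notMem hv
  have hneq : ∀ x ∈ S, x ≠ v := fun x hx h ↦ hv (h ▸ hx)
  -- With the least rank, `v` decides all its adjacencies by its own intervals; its position, the
  -- first free one, is never tested.
  refine ⟨fun x ↦ if x = v then 0 else d x + 1, fun x ↦ if x = v then S.ncard else p x,
    fun x i ↦ if x = v then (g i).1 else l x i, fun x i ↦ if x = v then (g i).2 else r x i,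
    ?_, ?_, ?_⟩
  · rw [hcard]
    rintro x (rfl | hx)
    · simp only [if_true]
      exact ⟨by omega, by omega, fun i ↦ ⟨(hg.1 i).1.trans (by omega), (hg.1 i).2.trans (by omega)⟩⟩
    · simp only [hneq x hx, if_false]
      obtain ⟨h1, h2, h3⟩ := hb x hx
      exact ⟨by omega, by omega, fun i ↦ ⟨(h3 i).1.trans (by omega), (h3 i).2.trans (by omega)⟩⟩
  · rintro x (rfl | hx) y (rfl | hy) h
    · rfl
    · simp only [if_true, hneq y hy, if_false] at h
      have := (hb y hy).2.1
      omega
    · simp only [if_true, hneq x hx, if_false] at h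
      have := (hb x hx).2.1
      omega
    · simp only [hneq x hx, hneq y hy, if_false] at h
      exact hp hx hy h
  · rintro x (rfl | hx) y (rfl | hy)
    · simp
    · simp [hneq y hy, hg.2 y hy]
    · rw [G.adj_comm]
      simp [hneq x hx, hg.2 x hx]
    · simp [hneq x hx, hneq y hy, hadj x hx y hy]

/-- Adding a twin to an interval model. -/
theorem HasIntervalModel.insert_of_twin [Finite V] {k : ℕ} {S : Set V} {u v : V} (hv : v ∉ S)
    (hu : u ∈ S) (hS : HasIntervalModel G k S) (hvu : ¬ G.Adj v u)
    (htwin : ∀ z ∈ S, (G.Adj z v ↔ G.Adj z u)) :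
    HasIntervalModel G k (insert v S) := by
  classical
  obtain ⟨d, p, l, r, hb, hp, hadj⟩ := hS
  have hcard : (insert v S).ncard = S.ncard + 1 := Set.ncard_insert_of_notMem hv
  have hneq : ∀ x ∈ S, x ≠ v := fun x hx h ↦ hv (h ▸ hx)
  -- `σ` frees the position `p u + 1` for `v`. Moving the endpoints by `σ` too makes a half-open
  -- interval contain `p u + 1` exactly when it contained `p u`. Equal ranks keep `u` and `v`
  -- non-adjacent.
  let σ : ℕ → ℕ := fun q ↦ if q ≤ p u then q else q + 1
  have hσ : ∀ q, q ≤ σ q ∧ σ q ≤ q + 1 := fun q ↦ by simp only [σ]; split_ifs <;> omega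
  have hσle : ∀ a b, σ a ≤ σ b ↔ a ≤ b := fun a b ↦ by simp only [σ]; split_ifs <;> omega
  have hσlt : ∀ a b, σ a < σ b ↔ a < b := fun a b ↦ by simp only [σ]; split_ifs <;> omega
  have hσu : ∀ a, σ a ≤ p u + 1 ↔ a ≤ p u := fun a ↦ by simp only [σ]; split_ifs <;> omega
  have hσu' : ∀ a, p u + 1 < σ a ↔ p u < a := fun a ↦ by simp only [σ]; split_ifs <;> omega
  have hσne : ∀ a, σ a ≠ p u + 1 := fun a ↦ by simp only [σ]; split_ifs <;> omega
  refine ⟨fun x ↦ if x = v then d u else d x, fun x ↦ if x = v then p u + 1 else σ (p x),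
    fun x i ↦ if x = v then σ (l u i) else σ (l x i),
    fun x i ↦ if x = v then σ (r u i) else σ (r x i), ?_, ?_, ?_⟩
  · rw [hcard]
    have key : ∀ x ∈ S, d x ≤ S.ncard + 1 ∧ p x + 1 < S.ncard + 1 ∧ σ (p x) < S.ncard + 1 ∧
        ∀ i, σ (l x i) ≤ S.ncard + 1 ∧ σ (r x i) ≤ S.ncard + 1 := by
      intro x hx
      obtain ⟨h1, h2, h3⟩ := hb x hx
      have := hσ (p x)
      refine ⟨by omega, by omega, by omega, fun i ↦ ?_⟩
      have := hσ (l x i)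
      have := hσ (r x i)
      have := h3 i
      omega
    rintro x (rfl | hx)
    · simp only [if_true]
      obtain ⟨h1, h2, -, h4⟩ := key u hu
      exact ⟨h1, h2, h4⟩
    · simp only [hneq x hx, if_false]
      obtain ⟨h1, -, h3, h4⟩ := key x hx
      exact ⟨h1, h3, h4⟩
  · rintro x (rfl | hx) y (rfl | hy) h
    · rfl
    · simp only [if_true, hneq y hy, if_false] at h
      exact (hσne _ h.symm).elim
    · simp only [if_true, hneq x hx, if_false] at h
      exact (hσne _ h).elim
    · simp only [hneq x hx, hneq y hy, if_false] at h
      refine hp hx hy (le_antisymm ((hσle _ _).1 h.le) ((hσle _ _).1 h.ge))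
  · rintro x (rfl | hx) y (rfl | hy)
    · simp
    · rw [G.adj_comm, htwin y hy, G.adj_comm]
      simp [hneq y hy, hadj u hu y hy, hσle, hσlt, hσu, hσu']
    · rw [htwin x hx]
      simp [hneq x hx, hadj x hx u hu, hσle, hσlt, hσu, hσu']
    · simp [hneq x hx, hneq y hy, hadj x hx y hy, hσle, hσlt]

/-- If all induced subgraphs have twins or a vertex of degree at most `k`, there is an interval
model with `k` intervals for each vertex. -/
theorem hasIntervalModel_of_twins_or_ncard_le [Finite V] {k : ℕ}
    (h : ∀ S : Set V, S.Nonempty →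
      (∃ u ∈ S, ∃ v ∈ S, u ≠ v ∧ ∀ z ∈ S, (G.Adj z u ↔ G.Adj z v)) ∨
        ∃ v ∈ S, {y | y ∈ S ∧ G.Adj v y}.ncard ≤ k) (S : Set V) :
    HasIntervalModel G k S := by
  induction S using WellFoundedLT.induction with
  | ind S ih =>
  rcases S.eq_empty_or_nonempty with rfl | hne
  · exact ⟨fun _ ↦ 0, fun _ ↦ 0, fun _ _ ↦ 0, fun _ _ ↦ 0, by simp, by simp, by simp⟩
  rcases h S hne with ⟨u, hu, v, hv, huv, htwin⟩ | ⟨v, hv, hdeg⟩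
  · have := ih (S \ {v}) (Set.sdiff_singleton_ssubset.2 hv)
    rw [← Set.insert_sdiff_self_of_mem hv]
    refine this.insert_of_twin (by simp) (u := u) ⟨hu, huv⟩ (fun hadj ↦ ?_)
      fun z hz ↦ (htwin z hz.1).symm
    -- The twin condition at `z = v` itself rules out an edge between `u` and `v`.
    exact G.loopless.irrefl _ ((htwin v hv).1 hadj)
  · have := ih (S \ {v}) (Set.sdiff_singleton_ssubset.2 hv)
    rw [← Set.insert_sdiff_self_of_mem hv]
    refine this.insert_of_ncard_le (by simp) ((Set.ncard_le_ncard ?_ (Set.toFinite _)).trans hdeg)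
    exact fun y hy ↦ ⟨hy.1.1, hy.2⟩

end

/-! ### Binary codes and their decoder. -/

/-- The number with given binary digits, least significant digit first. -/
def wordValue (w : List Bool) : ℕ :=
  w.foldr (fun b n ↦ b.toNat + 2 * n) 0

/-- The `j`-th of `K` numbers stored in a word, as blocks of digits of equal length. -/
def wordField (K j : ℕ) (w : List Bool) : ℕ :=
  wordValue w / (2 ^ (w.length / K)) ^ j % 2 ^ (w.length / K)

/-- The second vertex has larger rank, and its position is in an interval of the first one. -/
def WordsAdjacent (k : ℕ) (x y : List Bool) : Prop :=
  wordField (2 * k + 2) 0 x < wordField (2 * k + 2) 0 y ∧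
    ∃ i < k, wordField (2 * k + 2) (2 * i + 2) x ≤ wordField (2 * k + 2) 1 y ∧
      wordField (2 * k + 2) 1 y < wordField (2 * k + 2) (2 * i + 3) x

theorem primrec_wordValue : Primrec wordValue := by
  refine Primrec.list_foldr (α := List Bool) (β := Bool) (σ := ℕ)
    (h := fun _ q ↦ q.1.toNat + 2 * q.2) Primrec.id (Primrec.const 0) ?_
  exact Primrec.nat_add.comp ((Primrec.dom_bool Bool.toNat).comp (Primrec.fst.comp Primrec.snd))
    (Primrec.nat_mul.comp (Primrec.const 2) (Primrec.snd.comp Primrec.snd))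

theorem primrec_nat_pow : Primrec₂ ((· ^ ·) : ℕ → ℕ → ℕ) :=
  Primrec₂.unpaired'.1 Nat.Primrec.pow

theorem primrec_wordField (K j : ℕ) : Primrec (wordField K j) := by
  have hB : Primrec fun w : List Bool ↦ 2 ^ (w.length / K) :=
    primrec_nat_pow.comp (Primrec.const 2)
      (Primrec.nat_div.comp Primrec.list_length (Primrec.const K))
  exact Primrec.nat_mod.comp
    (Primrec.nat_div.comp primrec_wordValue (primrec_nat_pow.comp hB (Primrec.const j))) hB

theorem PrimrecPred.exists_lt_const {α : Type*} [Primcodable α] {p : ℕ → α → Prop}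
    (hp : ∀ i, PrimrecPred (p i)) (k : ℕ) : PrimrecPred fun a ↦ ∃ i < k, p i a := by
  induction k with
  | zero =>
    refine PrimrecPred.of_eq (p := fun a : α ↦ (0 : ℕ) = 1)
      (Primrec.eq.comp (Primrec.const 0) (Primrec.const 1)) fun a ↦ by simp
  | succ k ih =>
    refine (ih.or (hp k)).of_eq fun a ↦ ⟨?_, ?_⟩
    · rintro (⟨i, hi, h⟩ | h)
      · exact ⟨i, by omega, h⟩
      · exact ⟨k, by omega, h⟩
    · rintro ⟨i, hi, h⟩
      rcases Nat.lt_succ_iff_lt_or_eq.1 hi with hi | rfl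
      · exact Or.inl ⟨i, hi, h⟩
      · exact Or.inr h

theorem primrecRel_wordsAdjacent (k : ℕ) : PrimrecRel (WordsAdjacent k) := by
  have F1 : ∀ j, Primrec fun q : List Bool × List Bool ↦ wordField (2 * k + 2) j q.1 :=
    fun j ↦ (primrec_wordField _ j).comp Primrec.fst
  have F2 : ∀ j, Primrec fun q : List Bool × List Bool ↦ wordField (2 * k + 2) j q.2 :=
    fun j ↦ (primrec_wordField _ j).comp Primrec.snd
  exact PrimrecPred.and (Primrec.nat_lt.comp (F1 0) (F2 0)) (PrimrecPred.exists_lt_const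
    (fun i ↦ (Primrec.nat_le.comp (F1 (2 * i + 2)) (F2 1)).and
      (Primrec.nat_lt.comp (F2 1) (F1 (2 * i + 3)))) k)

theorem exists_wordValue_eq (L : ℕ) :
    ∀ N < 2 ^ L, ∃ w : List Bool, w.length = L ∧ wordValue w = N := by
  induction L with
  | zero =>
    intro N hN
    exact ⟨[], rfl, by simp at hN; simp [wordValue, hN]⟩
  | succ L ih =>
    intro N hN
    obtain ⟨w, hw, hwN⟩ := ih (N / 2) (by rw [pow_succ] at hN; omega)
    refine ⟨(decide (N % 2 = 1)) :: w, by simp [hw], ?_⟩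
    have hcons : wordValue (decide (N % 2 = 1) :: w) =
      (decide (N % 2 = 1)).toNat + 2 * wordValue w := rfl
    rw [hcons, hwN]
    rcases Nat.mod_two_eq_zero_or_one N with h | h <;> simp [h] <;> omega

theorem exists_lt_pow_and_div_mod_eq (b : ℕ) (K : ℕ) : ∀ f : ℕ → ℕ, (∀ j < K, f j < b) →
    ∃ M < b ^ K, ∀ j < K, M / b ^ j % b = f j := by
  induction K with
  | zero => exact fun f _ ↦ ⟨0, by simp, by simp⟩
  | succ K ih =>
    intro f hf
    obtain ⟨M, hM, hMf⟩ := ih (fun j ↦ f (j + 1)) fun j hj ↦ hf _ (by omega)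
    have h0 := hf 0 (by omega)
    refine ⟨f 0 + b * M, ?_, fun j hj ↦ ?_⟩
    · have : b * (M + 1) ≤ b * b ^ K := Nat.mul_le_mul_left _ hM
      rw [pow_succ']
      rw [mul_add, mul_one] at this
      omega
    · rcases j with _ | j
      · simp [Nat.mod_eq_of_lt h0]
      · rw [pow_succ', ← Nat.div_div_eq_div_mul, Nat.add_mul_div_left _ _ (by omega),
          Nat.div_eq_of_lt h0, zero_add]
        exact hMf j (by omega)

/-- Any `K` numbers below `2 ^ m` can be stored in a word of length `m * K`. -/
theorem exists_wordField_eq (K m : ℕ) (hK : 0 < K) (f : ℕ → ℕ) (hf : ∀ j < K, f j < 2 ^ m) :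
    ∃ w : List Bool, w.length = m * K ∧ ∀ j < K, wordField K j w = f j := by
  obtain ⟨M, hM, hMf⟩ := exists_lt_pow_and_div_mod_eq (2 ^ m) K f hf
  obtain ⟨w, hw, hwM⟩ := exists_wordValue_eq (m * K) M (by rwa [pow_mul])
  refine ⟨w, hw, fun j hj ↦ ?_⟩
  -- The length of the word reveals the block length `m`, so decoding needs no knowledge of `n`.
  rw [wordField, hw, hwM, Nat.mul_div_cancel _ hK]
  exact hMf j hj

/-- Graphs with interval models of bounded width admit an implicit representation. -/
theorem admitsImplicitRepresentation_of_hasIntervalModel {X : ∀ V : Type u, SimpleGraph V → Prop}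
    (k : ℕ) (hX : ∀ (V : Type u) [Finite V] (G : SimpleGraph V), X V G →
      HasIntervalModel G k Set.univ) :
    AdmitsImplicitRepresentation.{u} X := by
  classical
  refine ⟨fun x y ↦ decide (WordsAdjacent k x y ∨ WordsAdjacent k y x), 2 * k + 2,
    Primrec₂.to_comp ?_, fun V _ G hG ↦ ?_⟩
  · have h := (primrecRel_wordsAdjacent k)
    exact PrimrecPred.decide (PrimrecPred.or (h.comp Primrec.fst Primrec.snd)
      (h.comp Primrec.snd Primrec.fst))
  obtain ⟨d, p, l, r, hb, -, hadj⟩ := hX V G hG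
  set m := Nat.log 2 (Nat.card V) + 1
  have hlt : ∀ {a}, a ≤ (Set.univ : Set V).ncard → a < 2 ^ m := fun {a} h ↦ by
    rw [Set.ncard_univ] at h
    exact h.trans_lt (Nat.lt_pow_succ_log_self (by norm_num) _)
  -- Layout read by `WordsAdjacent`: rank, position, then left and right endpoints alternately.
  let f : V → ℕ → ℕ := fun v j ↦
    if j = 0 then d v else if j = 1 then p v else
      if h : (j - 2) / 2 < k then
        (if j % 2 = 0 then l v ⟨_, h⟩ else r v ⟨_, h⟩) else 0
  have f0 : ∀ v, f v 0 = d v := fun v ↦ rfl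
  have f1 : ∀ v, f v 1 = p v := fun v ↦ rfl
  have fl : ∀ v (i : Fin k), f v (2 * i.val + 2) = l v i := by
    intro v i
    simp [f]
  have fr : ∀ v (i : Fin k), f v (2 * i.val + 3) = r v i := by
    intro v i
    have h : (2 * i.val + 1) / 2 = i.val := by omega
    simp [f, h]
  have hf : ∀ v, ∀ j < 2 * k + 2, f v j < 2 ^ m := by
    intro v j _
    obtain ⟨h1, h2, h3⟩ := hb v (Set.mem_univ v)
    simp only [f]
    split_ifs
    · exact hlt h1
    · exact hlt h2.le
    · exact hlt (h3 _).1
    · exact hlt (h3 _).2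
    · positivity
  choose code hlen hcode using fun v ↦ exists_wordField_eq (2 * k + 2) m (by omega) (f v) (hf v)
  have key : ∀ x y, WordsAdjacent k (code x) (code y) ↔
      d x < d y ∧ ∃ i, l x i ≤ p y ∧ p y < r x i := by
    intro x y
    rw [WordsAdjacent, hcode x 0 (by omega), hcode y 0 (by omega), hcode y 1 (by omega), f0, f0, f1]
    refine and_congr_right fun _ ↦ ⟨?_, ?_⟩
    · rintro ⟨i, hi, h⟩
      rw [hcode x _ (by omega), hcode x _ (by omega)] at h
      exact ⟨⟨i, hi⟩, by rwa [fl x ⟨i, hi⟩, fr x ⟨i, hi⟩] at h⟩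
    · rintro ⟨i, h⟩
      refine ⟨i, i.isLt, ?_⟩
      rw [hcode x _ (by omega), hcode x _ (by omega), fl, fr]
      exact h
  refine ⟨code, fun v ↦ by rw [hlen, mul_comm], fun x y ↦ ?_⟩
  rw [decide_eq_true_iff, key, key]
  exact hadj x (Set.mem_univ x) y (Set.mem_univ y)

theorem mainTheorem7 {W : Type*} [Finite W] (H : SimpleGraph W) (hH : IsChainGraph H) :
    AdmitsImplicitRepresentation.{u}
      (fun _V G => IsChordalBipartite G ∧ IsIndFree H G) := by
  refine admitsImplicitRepresentation_of_hasIntervalModel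
    ((Nat.card W + 2) * (2 * Nat.card W)) fun V _ G hG ↦ ?_
  exact hasIntervalModel_of_twins_or_ncard_le
    (fun S hS ↦ exists_twins_or_ncard_le hH hG.1 hG.2 S hS) Set.univ
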